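/- Let $N\ge 1$, $0<s<1$, and let $\Omega\subset\mathbb R^N$ be a bounded open set whose boundary is locally the graph of a Lipschitz function, with $\Omega$ on one side. Let $(G_n)_{n\in\mathbb N}$ be Orlicz functions, that is, $G_n:\mathbb R\to\mathbb R$ is even, continuous, convex, strictly increasing on $(0,\infty)$, $G_n(0)=0$, there is $C_n>2$ with $G_n(2t)\le C_nG_n(t)$ for $t>0$, $G_n(t)/t\to0$ as $t\to0$ and $G_n(t)/t\to\infty$ as $t\to\infty$. Assume that $G_n$ is differentiable, put $g_n=G_n'$, and assume that $$0<p_n^-\le \frac{t\,g_n(t)}{G_n(t)}\le p_n^+\quad (t>0),\qquad p_n^-\to\infty,\qquad p_n^+\le\beta p_n^-\ \text{ for some fixed }\beta>1,$$ and that the $G_n$ are normalized so that $G_n(1)^{1/p_n^-}\to1$ (for example $G_n(1)=1$ for all $n$, or $G_n(t)=|t|^{p_n}/p_n$ with $p_n^\pm=p_n\to\infty$). Write $D^su(x,y)=\frac{u(x)-u(y)}{|x-y|^s}$ and $d\mu=\frac{dx\,dy}{|x-y|^N}$ on $\mathbb R^N\times\mathbb R^N$, and let $W_0^{s,G_n}(\Omega)$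 be the set of measurable $u:\mathbb R^N\to\mathbb R$ with $\int_{\mathbb R^N}G_n(u)\,dx<\infty$, $\iint G_n(D^su)\,d\mu<\infty$ and $u=0$ a.e. in $\mathbb R^N\setminus\Omega$. Let $f\in L^r(\Omega)$ with $r>1$ and, for all sufficiently large $n$, let $u_n\in W_0^{s,G_n}(\Omega)$ be a weak solution of $(-\Delta_{g_n})^su_n=f$ in $\Omega$, $u_n=0$ in $\mathbb R^N\setminus\Omega$: that is, both inequalities $\ge$ and $\le$ hold between $$\iint_{\mathbb R^N\times\mathbb R^N} g_n(D^su_n)\,D^sv\,d\mu \quad\text{and}\quad \int_\Omega f v\,dx$$ for every nonnegative $v\in W_0^{s,G_n}(\Omega)$. Let $u_\infty:\mathbb R^N\to\mathbb R$ be continuous and the limit of a subsequence $(u_{n_k})$, uniformly on $\mathbb R^N$ up to null sets, i.e. $\|u_{n_k}-u_\infty\|_{L^\infty(\mathbb R^N)}\to0$. Set $$Y=\Big\{\phi\in C^{0,s}(\mathbb R^N):\ \phi=0 \text{ in }\mathbb R^N\setminus\Omega,\ \sup_{x\ne y}\frac{|\phi(y)-\phi(x)|}{|x-y|^s}\le1\Big\}.$$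 Then $u_\infty\in Y$ and $$\int_\Omega f\,u_\infty\,dx=\max_{\psi\in Y}\int_\Omega f\,\psi\,dx .$$ -/

import Mathlib

open Filter Topology MeasureTheory
open scoped ENNReal NNReal

noncomputable section

/-- Orlicz functions `G : ℝ → ℝ`. -/
structure IsOrliczFunction (G : ℝ → ℝ) : Prop where
  even : ∀ t, G (-t) = G t
  continuous : Continuous G
  convexOn : ConvexOn ℝ Set.univ G
  strictMonoOn : StrictMonoOn G (Set.Ioi 0)
  map_zero : G 0 = 0
  doubling : ∃ C : ℝ, 2 < C ∧ ∀ t, 0 < t → G (2 * t) ≤ C * G t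
  tendsto_div_zero : Tendsto (fun x => G x / x) (𝓝[≠] 0) (𝓝 0)
  tendsto_div_atTop : Tendsto (fun x => G x / x) atTop atTop

/-- The growth condition `0 < p⁻ ≤ t g(t) / G(t) ≤ p⁺` for `t > 0`, where `g = G'`.
For an Orlicz function, differentiability at every `t > 0` gives differentiability on `ℝ`,
and then `deriv G` is odd. -/
structure HasGrowth (G : ℝ → ℝ) (pminus pplus : ℝ) : Prop where
  pos : 0 < pminus
  differentiableAt : ∀ t, 0 < t → DifferentiableAt ℝ G t
  lower : ∀ t, 0 < t → pminus ≤ t * deriv G t / G t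
  upper : ∀ t, 0 < t → t * deriv G t / G t ≤ pplus

/-- The Hölder quotient `D^s u (x, y) = (u x - u y) / |x - y|^s`. -/
def holderQuotient {N : ℕ} (s : ℝ) (u : EuclideanSpace ℝ (Fin N) → ℝ)
    (z : EuclideanSpace ℝ (Fin N) × EuclideanSpace ℝ (Fin N)) : ℝ :=
  (u z.1 - u z.2) / ‖z.1 - z.2‖ ^ s

/-- The measure `dμ = dx dy / |x - y|^N` on `ℝ^N × ℝ^N`. -/
def muMeasure (N : ℕ) :
    Measure (EuclideanSpace ℝ (Fin N) × EuclideanSpace ℝ (Fin N)) :=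
  (volume.prod volume).withDensity (fun z => ENNReal.ofReal ((‖z.1 - z.2‖ ^ N)⁻¹))

/-- The modular `Φ_G(u) = ∫ G(u) dx`. -/
def modular {N : ℕ} (G : ℝ → ℝ) (u : EuclideanSpace ℝ (Fin N) → ℝ) : ℝ≥0∞ :=
  ∫⁻ x, ENNReal.ofReal (G (u x))

/-- The modular `Φ_{s,G}(u) = ∬ G(D^s u) dμ`. -/
def fracModular {N : ℕ} (s : ℝ) (G : ℝ → ℝ) (u : EuclideanSpace ℝ (Fin N) → ℝ) : ℝ≥0∞ :=
  ∫⁻ z, ENNReal.ofReal (G (holderQuotient s u z)) ∂(muMeasure N)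

/-- The fractional Orlicz-Sobolev space `W^{s,G}(ℝ^N)`, as a set of functions
(Lebesgue measurable means `AEMeasurable`). -/
def fracOrliczSobolev (N : ℕ) (s : ℝ) (G : ℝ → ℝ) : Set (EuclideanSpace ℝ (Fin N) → ℝ) :=
  {u | AEMeasurable u volume ∧ modular G u < ⊤ ∧ fracModular s G u < ⊤}

/-- The space `W_0^{s,G}(Ω)` of all `u ∈ W^{s,G}(ℝ^N)` with `u = 0` a.e. outside `Ω`. -/
def fracOrliczSobolevZero {N : ℕ} (s : ℝ) (G : ℝ → ℝ) (Ω : Set (EuclideanSpace ℝ (Fin N))) :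
    Set (EuclideanSpace ℝ (Fin N) → ℝ) :=
  {u | u ∈ fracOrliczSobolev N s G ∧ ∀ᵐ x, x ∉ Ω → u x = 0}

/-- The pairing `⟨(-Δ_g)^s u, v⟩ = ∬ g(D^s u) D^s v dμ` with `g = G'`. For `u`, `v` in
`W^{s,G}(ℝ^N)`, with `G` Orlicz and of controlled growth, the integrand is integrable. -/
def gLaplacePairing {N : ℕ} (s : ℝ) (G : ℝ → ℝ) (u v : EuclideanSpace ℝ (Fin N) → ℝ) : ℝ :=
  ∫ z, deriv G (holderQuotient s u z) * holderQuotient s v z ∂(muMeasure N)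

/-- Weak supersolutions of `(-Δ_g)^s u = f` in `Ω`, `u = 0` outside `Ω`. -/
def IsWeakSupersolution {N : ℕ} (s : ℝ) (G : ℝ → ℝ) (Ω : Set (EuclideanSpace ℝ (Fin N)))
    (f u : EuclideanSpace ℝ (Fin N) → ℝ) : Prop :=
  u ∈ fracOrliczSobolevZero s G Ω ∧
    ∀ v ∈ fracOrliczSobolevZero s G Ω, (∀ x, 0 ≤ v x) →
      ∫ x in Ω, f x * v x ≤ gLaplacePairing s G u v

/-- Weak subsolutions of `(-Δ_g)^s u = f` in `Ω`, `u = 0` outside `Ω`. -/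
def IsWeakSubsolution {N : ℕ} (s : ℝ) (G : ℝ → ℝ) (Ω : Set (EuclideanSpace ℝ (Fin N)))
    (f u : EuclideanSpace ℝ (Fin N) → ℝ) : Prop :=
  u ∈ fracOrliczSobolevZero s G Ω ∧
    ∀ v ∈ fracOrliczSobolevZero s G Ω, (∀ x, 0 ≤ v x) →
      gLaplacePairing s G u v ≤ ∫ x in Ω, f x * v x

/-- Weak solutions of `(-Δ_g)^s u = f` in `Ω`, `u = 0` outside `Ω`. -/
def IsWeakSolution {N : ℕ} (s : ℝ) (G : ℝ → ℝ) (Ω : Set (EuclideanSpace ℝ (Fin N)))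
    (f u : EuclideanSpace ℝ (Fin N) → ℝ) : Prop :=
  IsWeakSupersolution s G Ω f u ∧ IsWeakSubsolution s G Ω f u

/-- The boundary of `Ω` is locally the graph of a Lipschitz function with `Ω` on one side:
near each boundary point, for some unit vector `e`, the set `Ω` consists of the points whose
coordinate in direction `e` exceeds a Lipschitz function `γ` of the orthogonal projection
of the point to the hyperplane `e^⊥`. (Only the values of `γ` on `e^⊥` matter; a Lipschitz
function on `e^⊥` extends to the whole space by composition with the projection.) -/
def HasLipschitzBoundary {N : ℕ} (Ω : Set (EuclideanSpace ℝ (Fin N))) : Prop :=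
  ∀ x₀ ∈ frontier Ω, ∃ (r : ℝ) (e : EuclideanSpace ℝ (Fin N)) (K : ℝ≥0)
    (γ : EuclideanSpace ℝ (Fin N) → ℝ), 0 < r ∧ ‖e‖ = 1 ∧ LipschitzWith K γ ∧
      ∀ x ∈ Metric.ball x₀ r, (x ∈ Ω ↔ γ (x - inner ℝ e x • e) < inner ℝ e x)

/-- The set `Y` of all `φ ∈ C^{0,s}(ℝ^N)` that vanish outside `Ω` and whose `s`-Hölder
seminorm is at most `1`. (The seminorm bound gives Hölder continuity; if `Ω` is bounded
and `N ≥ 1` such functions are bounded.) -/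
def holderUnitBall {N : ℕ} (s : ℝ) (Ω : Set (EuclideanSpace ℝ (Fin N))) :
    Set (EuclideanSpace ℝ (Fin N) → ℝ) :=
  {φ | (∀ x, x ∉ Ω → φ x = 0) ∧ ∀ x y, x ≠ y → |φ y - φ x| / ‖x - y‖ ^ s ≤ 1}

end

/-! Convexity makes a weak solution `u n` a minimizer of the energy `∬ G n (D^s v) dμ - ∫ f v`
(`IsWeakSolution.energy_le`), and as the exponents blow up this energy turns into `-∫ f v` with the
constraint `|D^s v| ≤ 1`.

The growth condition makes `G t * t ^ (-p)` increasing, so `G n` lies above `G n 1 * t ^ p` for `t ≥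
1` and below it for `t ≤ 1`. By the normalization, `G n 1 * c ^ p` tends to infinity for `c > 1` and
to zero for `0 < c < 1`.

Competitor `0` bounds the energies of `u n`. If the limit had Hölder quotient above some `c > 1` at
one pair of points, the same would hold on an open set of positive measure, and the energies would
blow up (`abs_sub_le_rpow_of_bounded_fracModular`).

Competitor `c • φ`, with `φ` in the Hölder ball and `0 < c < 1`, has energy at most `G n 1 * c ^ p`
times `∬ |D^s φ| dμ`. Once that integral is finite, the limit gives `c ∫ f φ ≤ ∫ f uinf`, and then
`c → 1`. Near the diagonal `μ` is too singular for a mere Hölder bound to give finiteness, but a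
Lipschitz bound suffices because `s < 1`; Lipschitz elements are uniformly dense in the ball
(`exists_lipschitz_approx`). -/

namespace IsOrliczFunction

/-! ### Orlicz functions: convexity inequalities and power bounds. -/

variable {G : ℝ → ℝ}

lemma nonneg (hG : IsOrliczFunction G) (t : ℝ) : 0 ≤ G t := by
  have h := hG.convexOn.2 (Set.mem_univ t) (Set.mem_univ (-t))
    (show (0 : ℝ) ≤ 1 / 2 by norm_num) (show (0 : ℝ) ≤ 1 / 2 by norm_num) (by norm_num)
  simp only [smul_eq_mul, hG.even] at h
  rw [show (1 / 2 * t + 1 / 2 * -t : ℝ) = 0 by ring, hG.map_zero] at h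
  linarith

lemma pos (hG : IsOrliczFunction G) {t : ℝ} (ht : 0 < t) : 0 < G t :=
  (hG.nonneg (t / 2)).trans_lt
    (hG.strictMonoOn (Set.mem_Ioi.2 (by positivity)) (Set.mem_Ioi.2 ht) (by linarith))

lemma map_abs (hG : IsOrliczFunction G) (t : ℝ) : G |t| = G t := by
  rcases abs_choice t with h | h <;> rw [h]
  exact hG.even t

lemma le_of_abs_le (hG : IsOrliczFunction G) {a b : ℝ} (h : |a| ≤ |b|) : G a ≤ G b := by
  rw [← hG.map_abs a, ← hG.map_abs b]
  rcases (abs_nonneg a).eq_or_lt with ha | ha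
  · rw [← ha, hG.map_zero]
    exact hG.nonneg _
  · exact hG.strictMonoOn.monotoneOn (Set.mem_Ioi.2 ha) (Set.mem_Ioi.2 (ha.trans_le h)) h

/-- Midpoint convexity at `2 * a` and `2 * b`, followed by doubling, which evenness extends to all
reals. -/
lemma exists_add_le (hG : IsOrliczFunction G) :
    ∃ C : ℝ, 0 ≤ C ∧ ∀ a b, G (a + b) ≤ C * (G a + G b) := by
  obtain ⟨C, hC, hd⟩ := hG.doubling
  have hd' : ∀ t, G (2 * t) ≤ C * G t := fun t => by
    rcases (abs_nonneg t).eq_or_lt with h | h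
    · rw [abs_eq_zero.1 h.symm]
      simp [hG.map_zero]
    · have := hd _ h
      rwa [hG.map_abs, ← hG.map_abs (2 * |t|), abs_mul, abs_abs, ← abs_mul, hG.map_abs] at this
  refine ⟨C / 2, by linarith, fun a b => ?_⟩
  have h := hG.convexOn.2 (Set.mem_univ (2 * a)) (Set.mem_univ (2 * b))
    (show (0 : ℝ) ≤ 1 / 2 by norm_num) (show (0 : ℝ) ≤ 1 / 2 by norm_num) (by norm_num)
  simp only [smul_eq_mul] at h
  rw [show (1 / 2 * (2 * a) + 1 / 2 * (2 * b) : ℝ) = a + b by ring] at h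
  linarith [hd' a, hd' b]

lemma differentiable (hG : IsOrliczFunction G) (hd : ∀ t, 0 < t → DifferentiableAt ℝ G t) :
    Differentiable ℝ G := by
  intro t
  rcases lt_trichotomy t 0 with h | rfl | h
  · have h1 : DifferentiableAt ℝ (fun x => G (-x)) t :=
      DifferentiableAt.comp t (hd (-t) (by linarith)) differentiableAt_id.neg
    simpa only [hG.even] using h1
  -- The difference quotient at `0` is `G x / x`, so the limit assumed there is the derivative.
  · have : HasDerivAt G 0 0 := by
      rw [hasDerivAt_iff_tendsto_slope_zero]
      refine hG.tendsto_div_zero.congr fun x => ?_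
      simp [hG.map_zero, div_eq_inv_mul]
    exact this.differentiableAt
  · exact hd t h

lemma add_deriv_mul_le (hG : IsOrliczFunction G) (hd : Differentiable ℝ G) (a b : ℝ) :
    G a + deriv G a * (b - a) ≤ G b := by
  rcases lt_trichotomy a b with h | rfl | h
  · have := hG.convexOn.le_slope_of_hasDerivAt (Set.mem_univ _) (Set.mem_univ _) h
      (hd a).hasDerivAt
    rw [slope_def_field, le_div_iff₀ (by linarith)] at this
    linarith
  · simp
  · have := hG.convexOn.slope_le_of_hasDerivAt (Set.mem_univ _) (Set.mem_univ _) h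
      (hd a).hasDerivAt
    rw [slope_def_field, div_le_iff₀ (by linarith)] at this
    linarith

/-- Stands in for Young's inequality: the tangent line at `a`, evaluated at `a + b` and `a - b`,
bounds the product from both sides. This makes the pairing integrable. -/
lemma exists_abs_deriv_mul_le (hG : IsOrliczFunction G) (hd : Differentiable ℝ G) :
    ∃ C : ℝ, 0 ≤ C ∧ ∀ a b, |deriv G a * b| ≤ C * (G a + G b) := by
  obtain ⟨C, hC, h⟩ := hG.exists_add_le
  refine ⟨C, hC, fun a b => abs_le.2 ⟨?_, ?_⟩⟩
  · have h1 := hG.add_deriv_mul_le hd a (a + -b)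
    have h2 := h a (-b)
    rw [hG.even] at h2
    rw [add_sub_cancel_left] at h1
    linarith [hG.nonneg a]
  · have h1 := hG.add_deriv_mul_le hd a (a + b)
    rw [add_sub_cancel_left] at h1
    linarith [hG.nonneg a, h a b]

/-- The derivative is `t ^ (-p - 1) * (t * deriv G t - p * G t)`, nonnegative by the lower growth
bound. Comparison with `t = 1` yields both power bounds below. -/
lemma monotoneOn_mul_rpow_neg (hG : IsOrliczFunction G) {p q : ℝ} (hg : HasGrowth G p q) :
    MonotoneOn (fun t => G t * t ^ (-p)) (Set.Ioi 0) := by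
  have hD : ∀ t ∈ Set.Ioi (0 : ℝ), HasDerivAt (fun t => G t * t ^ (-p))
      (deriv G t * t ^ (-p) + G t * (-p * t ^ (-p - 1))) t := fun t ht =>
    (hg.differentiableAt t ht).hasDerivAt.mul (Real.hasDerivAt_rpow_const (Or.inl (ne_of_gt ht)))
  refine monotoneOn_of_deriv_nonneg (convex_Ioi 0)
    (fun t ht => (hD t ht).continuousAt.continuousWithinAt) ?_ ?_
  · rw [interior_Ioi]
    exact fun t ht => (hD t ht).differentiableAt.differentiableWithinAt
  · rw [interior_Ioi]
    intro t ht
    have ht' : 0 < t := ht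
    rw [(hD t ht).deriv, Real.rpow_sub_one ht'.ne']
    have h := hg.lower t ht
    rw [le_div_iff₀ (hG.pos ht)] at h
    have : deriv G t * t ^ (-p) + G t * (-p * (t ^ (-p) / t))
        = t ^ (-p) / t * (t * deriv G t - p * G t) := by
      field_simp
      ring
    rw [this]
    exact mul_nonneg (div_nonneg (Real.rpow_nonneg ht'.le _) ht'.le) (by linarith)

lemma mul_rpow_le (hG : IsOrliczFunction G) {p q : ℝ} (hg : HasGrowth G p q) {t : ℝ}
    (ht : 1 ≤ t) : G 1 * t ^ p ≤ G t := by
  have h0 : 0 < t := by linarith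
  have h := hG.monotoneOn_mul_rpow_neg hg (Set.mem_Ioi.2 one_pos) (Set.mem_Ioi.2 h0) ht
  simp only [Real.one_rpow, mul_one] at h
  rwa [Real.rpow_neg h0.le, ← div_eq_mul_inv, le_div_iff₀ (Real.rpow_pos_of_pos h0 _)] at h

lemma le_mul_rpow (hG : IsOrliczFunction G) {p q : ℝ} (hg : HasGrowth G p q) {t : ℝ}
    (h0 : 0 ≤ t) (ht : t ≤ 1) : G t ≤ G 1 * t ^ p := by
  rcases h0.eq_or_lt with rfl | h0
  · rw [hG.map_zero, Real.zero_rpow hg.pos.ne', mul_zero]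
  have h := hG.monotoneOn_mul_rpow_neg hg (Set.mem_Ioi.2 h0) (Set.mem_Ioi.2 one_pos) ht
  simp only [Real.one_rpow, mul_one] at h
  rwa [Real.rpow_neg h0.le, ← div_eq_mul_inv, div_le_iff₀ (Real.rpow_pos_of_pos h0 _)] at h

end IsOrliczFunction

/-! ### Limits of `G n 1 * c ^ p n` under the normalization. -/

lemma tendsto_mul_rpow_atTop {b p : ℕ → ℝ} (hb : ∀ n, 0 < b n) (hp : Tendsto p atTop atTop)
    (h : Tendsto (fun n => b n ^ (1 / p n)) atTop (𝓝 1)) {c : ℝ} (hc : 1 < c) :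
    Tendsto (fun n => b n * c ^ p n) atTop atTop := by
  have h1 : Tendsto (fun n => b n ^ (1 / p n) * c) atTop (𝓝 c) := by
    simpa using h.mul_const c
  -- Since `b * c ^ p = (b ^ (1 / p) * c) ^ p` and the base tends to `c`, it eventually exceeds the
  -- midpoint of `1` and `c`, itself above `1`.
  have h2 : Tendsto (fun n => ((1 + c) / 2) ^ p n) atTop atTop :=
    (tendsto_rpow_atTop_of_base_gt_one _ (by linarith)).comp hp
  refine tendsto_atTop_mono' _ ?_ h2
  filter_upwards [h1.eventually (lt_mem_nhds (show (1 + c) / 2 < c by linarith)),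
    hp.eventually_gt_atTop 0] with n hn hpn
  calc ((1 + c) / 2) ^ p n ≤ (b n ^ (1 / p n) * c) ^ p n :=
        Real.rpow_le_rpow (by linarith) hn.le hpn.le
    _ = b n * c ^ p n := by
        rw [Real.mul_rpow (Real.rpow_nonneg (hb n).le _) (by linarith), ← Real.rpow_mul (hb n).le,
          one_div_mul_cancel hpn.ne', Real.rpow_one]

lemma tendsto_mul_rpow_zero {b p : ℕ → ℝ} (hb : ∀ n, 0 < b n) (hp : Tendsto p atTop atTop)
    (h : Tendsto (fun n => b n ^ (1 / p n)) atTop (𝓝 1)) {c : ℝ} (hc0 : 0 < c) (hc : c < 1) :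
    Tendsto (fun n => b n * c ^ p n) atTop (𝓝 0) := by
  have h1 : Tendsto (fun n => b n ^ (1 / p n) * c) atTop (𝓝 c) := by
    simpa using h.mul_const c
  have h2 : Tendsto (fun n => ((1 + c) / 2) ^ p n) atTop (𝓝 0) :=
    (tendsto_rpow_atTop_of_base_lt_one _ (by linarith) (by linarith)).comp hp
  refine tendsto_of_tendsto_of_tendsto_of_le_of_le' tendsto_const_nhds h2
    (Eventually.of_forall fun n => mul_nonneg (hb n).le (Real.rpow_nonneg hc0.le _)) ?_
  filter_upwards [h1.eventually (gt_mem_nhds (show c < (1 + c) / 2 by linarith)),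
    hp.eventually_gt_atTop 0] with n hn hpn
  calc b n * c ^ p n = (b n ^ (1 / p n) * c) ^ p n := by
        rw [Real.mul_rpow (Real.rpow_nonneg (hb n).le _) hc0.le, ← Real.rpow_mul (hb n).le,
          one_div_mul_cancel hpn.ne', Real.rpow_one]
    _ ≤ ((1 + c) / 2) ^ p n :=
        Real.rpow_le_rpow (mul_nonneg (Real.rpow_nonneg (hb n).le _) hc0.le) hn.le hpn.le

/-! ### Weak solutions as energy minimizers. -/

section Energy

variable {N : ℕ} {s : ℝ} {G : ℝ → ℝ} {Ω : Set (EuclideanSpace ℝ (Fin N))}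
  {f u v : EuclideanSpace ℝ (Fin N) → ℝ}

lemma muMeasure_absolutelyContinuous (N : ℕ) :
    muMeasure N ≪ (volume : Measure (EuclideanSpace ℝ (Fin N))).prod volume :=
  withDensity_absolutelyContinuous _ _

lemma aemeasurable_holderQuotient (s : ℝ) (hu : AEMeasurable u volume) :
    AEMeasurable (holderQuotient s u) (muMeasure N) := by
  have h1 : AEMeasurable (fun z : EuclideanSpace ℝ (Fin N) × EuclideanSpace ℝ (Fin N) => u z.1)
      (volume.prod volume) := hu.comp_quasiMeasurePreserving Measure.quasiMeasurePreserving_fst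
  have h2 : AEMeasurable (fun z : EuclideanSpace ℝ (Fin N) × EuclideanSpace ℝ (Fin N) => u z.2)
      (volume.prod volume) := hu.comp_quasiMeasurePreserving Measure.quasiMeasurePreserving_snd
  have h3 : Measurable (fun z : EuclideanSpace ℝ (Fin N) × EuclideanSpace ℝ (Fin N) =>
      ‖z.1 - z.2‖ ^ s) := by fun_prop
  exact ((h1.sub h2).div h3.aemeasurable).mono_ac (muMeasure_absolutelyContinuous N)

lemma integrable_comp_holderQuotient (hG : IsOrliczFunction G)
    (hu : u ∈ fracOrliczSobolevZero s G Ω) :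
    Integrable (fun z => G (holderQuotient s u z)) (muMeasure N) := by
  refine ⟨(hG.continuous.measurable.comp_aemeasurable
    (aemeasurable_holderQuotient s hu.1.1)).aestronglyMeasurable, ?_⟩
  rw [hasFiniteIntegral_iff_ofReal (Eventually.of_forall fun z => hG.nonneg _)]
  exact hu.1.2.2

lemma fracModular_eq_ofReal_integral (hG : IsOrliczFunction G)
    (hu : u ∈ fracOrliczSobolevZero s G Ω) :
    fracModular s G u = ENNReal.ofReal (∫ z, G (holderQuotient s u z) ∂(muMeasure N)) :=
  (ofReal_integral_eq_lintegral_ofReal (integrable_comp_holderQuotient hG hu)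
    (Eventually.of_forall fun _ => hG.nonneg _)).symm

lemma integrable_deriv_mul_holderQuotient (hG : IsOrliczFunction G) (hd : Differentiable ℝ G)
    (hu : u ∈ fracOrliczSobolevZero s G Ω) (hv : v ∈ fracOrliczSobolevZero s G Ω) :
    Integrable (fun z => deriv G (holderQuotient s u z) * holderQuotient s v z)
      (muMeasure N) := by
  obtain ⟨C, -, h⟩ := hG.exists_abs_deriv_mul_le hd
  refine Integrable.mono' (((integrable_comp_holderQuotient hG hu).add
    (integrable_comp_holderQuotient hG hv)).const_mul C) ?_
    (Eventually.of_forall fun z => h _ _)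
  exact (((measurable_deriv G).comp_aemeasurable (aemeasurable_holderQuotient s hu.1.1)).mul
    (aemeasurable_holderQuotient s hv.1.1)).aestronglyMeasurable

lemma mem_fracOrliczSobolevZero_of_abs_le (hG : IsOrliczFunction G)
    (hu : u ∈ fracOrliczSobolevZero s G Ω) (hv : AEMeasurable v volume)
    (h1 : ∀ x, |v x| ≤ |u x|) (h2 : ∀ x y, |v x - v y| ≤ |u x - u y|) :
    v ∈ fracOrliczSobolevZero s G Ω := by
  refine ⟨⟨hv, (lintegral_mono fun x => ?_).trans_lt hu.1.2.1,
    (lintegral_mono fun z => ?_).trans_lt hu.1.2.2⟩, ?_⟩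
  · exact ENNReal.ofReal_le_ofReal (hG.le_of_abs_le (h1 x))
  · refine ENNReal.ofReal_le_ofReal (hG.le_of_abs_le ?_)
    simp only [holderQuotient, abs_div]
    exact div_le_div_of_nonneg_right (h2 _ _) (abs_nonneg _)
  · filter_upwards [hu.2] with x hx hxΩ
    have := h1 x
    rw [hx hxΩ, abs_zero] at this
    exact abs_nonpos_iff.1 this

/-- Test functions are required to be nonnegative, so `v` is split into positive and negative parts.
Both stay admissible because truncation is 1-Lipschitz and fixes `0`. -/
lemma IsWeakSolution.gLaplacePairing_eq (hG : IsOrliczFunction G) (hd : Differentiable ℝ G)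
    (hu : IsWeakSolution s G Ω f u) (hv : v ∈ fracOrliczSobolevZero s G Ω)
    (hfv : IntegrableOn (fun x => f x * v x) Ω) (hf : AEStronglyMeasurable f (volume.restrict Ω)) :
    gLaplacePairing s G u v = ∫ x in Ω, f x * v x := by
  set vp : EuclideanSpace ℝ (Fin N) → ℝ := fun x => max (v x) 0 with hvp
  set vm : EuclideanSpace ℝ (Fin N) → ℝ := fun x => max (-v x) 0 with hvm
  have hsub : ∀ x, v x = vp x - vm x := fun x => by
    simp only [hvp, hvm]
    rcases le_total 0 (v x) with h | h
    · rw [max_eq_left h, max_eq_right (by linarith)]; ring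
    · rw [max_eq_right h, max_eq_left (by linarith)]; ring
  have hmp : AEMeasurable vp volume := hv.1.1.max aemeasurable_const
  have hmm : AEMeasurable vm volume := hv.1.1.neg.max aemeasurable_const
  have habsp : ∀ x, |vp x| ≤ |v x| := fun x => by
    simp only [hvp]
    rw [abs_of_nonneg (le_max_right _ _)]
    exact max_le (le_abs_self _) (abs_nonneg _)
  have habsm : ∀ x, |vm x| ≤ |v x| := fun x => by
    simp only [hvm]
    rw [abs_of_nonneg (le_max_right _ _)]
    exact max_le (neg_le_abs _) (abs_nonneg _)
  have hvpW : vp ∈ fracOrliczSobolevZero s G Ω :=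
    mem_fracOrliczSobolevZero_of_abs_le hG hv hmp habsp fun x y =>
    abs_max_sub_max_le_abs _ _ _
  have hvmW : vm ∈ fracOrliczSobolevZero s G Ω :=
    mem_fracOrliczSobolevZero_of_abs_le hG hv hmm habsm fun x y =>
    (abs_max_sub_max_le_abs _ _ _).trans_eq (by rw [neg_sub_neg, abs_sub_comm])
  have hip : IntegrableOn (fun x => f x * vp x) Ω :=
    Integrable.mono hfv (hf.mul hmp.restrict.aestronglyMeasurable) (Eventually.of_forall fun x => by
      simp only [norm_mul, Real.norm_eq_abs]
      exact mul_le_mul_of_nonneg_left (habsp x) (abs_nonneg _))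
  have him : IntegrableOn (fun x => f x * vm x) Ω :=
    Integrable.mono hfv (hf.mul hmm.restrict.aestronglyMeasurable) (Eventually.of_forall fun x => by
      simp only [norm_mul, Real.norm_eq_abs]
      exact mul_le_mul_of_nonneg_left (habsm x) (abs_nonneg _))
  have hp := le_antisymm (hu.2.2 vp hvpW fun x => le_max_right _ _)
    (hu.1.2 vp hvpW fun x => le_max_right _ _)
  have hm := le_antisymm (hu.2.2 vm hvmW fun x => le_max_right _ _)
    (hu.1.2 vm hvmW fun x => le_max_right _ _)
  calc gLaplacePairing s G u v = gLaplacePairing s G u vp - gLaplacePairing s G u vm := by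
        unfold gLaplacePairing
        rw [← integral_sub (integrable_deriv_mul_holderQuotient hG hd hu.1.1 hvpW)
          (integrable_deriv_mul_holderQuotient hG hd hu.1.1 hvmW)]
        congr 1
        ext z
        simp only [holderQuotient]
        rw [hsub z.1, hsub z.2]
        ring
    _ = ∫ x in Ω, f x * v x := by
        rw [hp, hm, ← integral_sub hip him]
        congr 1
        ext x
        rw [hsub x]
        ring

/-- A weak solution minimizes the energy `v ↦ ∬ G(D^s v) dμ - ∫ f v`. -/
lemma IsWeakSolution.energy_le (hG : IsOrliczFunction G) (hd : Differentiable ℝ G)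
    (hu : IsWeakSolution s G Ω f u) (hv : v ∈ fracOrliczSobolevZero s G Ω)
    (hfu : IntegrableOn (fun x => f x * u x) Ω)
    (hfv : IntegrableOn (fun x => f x * v x) Ω) (hf : AEStronglyMeasurable f (volume.restrict Ω)) :
    (∫ z, G (holderQuotient s u z) ∂(muMeasure N)) + ∫ x in Ω, f x * v x ≤
      (∫ z, G (holderQuotient s v z) ∂(muMeasure N)) + ∫ x in Ω, f x * u x := by
  -- With `∫ f v` and `∫ f u` rewritten as pairings, the claim is the tangent inequality integrated
  -- against `μ`.
  rw [← hu.gLaplacePairing_eq hG hd hv hfv hf, ← hu.gLaplacePairing_eq hG hd hu.1.1 hfu hf]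
  unfold gLaplacePairing
  rw [← integral_add (integrable_comp_holderQuotient hG hu.1.1)
      (integrable_deriv_mul_holderQuotient hG hd hu.1.1 hv),
    ← integral_add (integrable_comp_holderQuotient hG hv)
      (integrable_deriv_mul_holderQuotient hG hd hu.1.1 hu.1.1)]
  refine integral_mono ((integrable_comp_holderQuotient hG hu.1.1).add
      (integrable_deriv_mul_holderQuotient hG hd hu.1.1 hv))
      ((integrable_comp_holderQuotient hG hv).add
      (integrable_deriv_mul_holderQuotient hG hd hu.1.1 hu.1.1)) fun z => ?_
  have := hG.add_deriv_mul_le hd (holderQuotient s u z) (holderQuotient s v z)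
  dsimp only
  linarith

end Energy

/-! ### Lipschitz approximation in the Hölder unit ball. -/

lemma exists_rpow_le_mul_add {s : ℝ} (hs0 : 0 < s) (hs1 : s < 1) {ε : ℝ} (hε : 0 < ε) :
    ∃ L : ℝ, 0 < L ∧ ∀ t, 0 ≤ t → t ^ s ≤ L * t + ε := by
  have hδ : 0 < ε ^ (1 / s) := Real.rpow_pos_of_pos hε _
  -- At the threshold `ε ^ (1 / s)` the power `t ^ s` equals `ε`. Beyond it, `t ^ s = t ^ (s - 1) *
  -- t` and the first factor is decreasing.
  refine ⟨(ε ^ (1 / s)) ^ (s - 1), Real.rpow_pos_of_pos hδ _, fun t ht => ?_⟩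
  rcases le_total t (ε ^ (1 / s)) with h | h
  · have : t ^ s ≤ ε := by
      calc t ^ s ≤ (ε ^ (1 / s)) ^ s := Real.rpow_le_rpow ht h hs0.le
        _ = ε := by rw [← Real.rpow_mul hε.le, one_div_mul_cancel hs0.ne', Real.rpow_one]
    have := mul_nonneg (Real.rpow_pos_of_pos hδ (s - 1)).le ht
    linarith
  · have ht' : 0 < t := hδ.trans_le h
    have : t ^ s = t ^ (s - 1) * t := by
      rw [Real.rpow_sub_one ht'.ne', div_mul_cancel₀ _ ht'.ne']
    rw [this]
    have h2 : t ^ (s - 1) ≤ (ε ^ (1 / s)) ^ (s - 1) :=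
      Real.rpow_le_rpow_of_nonpos hδ h (by linarith)
    have := mul_le_mul_of_nonneg_right h2 ht
    linarith

section HolderUnitBall

variable {N : ℕ} {s : ℝ} {Ω : Set (EuclideanSpace ℝ (Fin N))}
  {φ ψ : EuclideanSpace ℝ (Fin N) → ℝ}

lemma mem_holderUnitBall_iff (hs0 : 0 < s) :
    φ ∈ holderUnitBall s Ω ↔
      (∀ x, x ∉ Ω → φ x = 0) ∧ ∀ x y, |φ x - φ y| ≤ ‖x - y‖ ^ s := by
  refine and_congr Iff.rfl ⟨fun h x y => ?_, fun h x y hxy => ?_⟩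
  · rcases eq_or_ne x y with rfl | hxy
    · simp [Real.zero_rpow hs0.ne']
    · have := h x y hxy
      rw [div_le_one (Real.rpow_pos_of_pos (norm_pos_iff.2 (sub_ne_zero.2 hxy)) _)] at this
      rwa [abs_sub_comm]
  · rw [div_le_one (Real.rpow_pos_of_pos (norm_pos_iff.2 (sub_ne_zero.2 hxy)) _), abs_sub_comm]
    exact h x y

/-- The infimal convolution of `ψ` with the cone `h ↦ L * ‖h‖`. -/
noncomputable def coneInfConv {E : Type*} [NormedAddCommGroup E] (L : ℝ) (ψ : E → ℝ) (x : E) : ℝ :=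
  ⨅ h : E, (ψ (x + h) + L * ‖h‖)

/-- Source of both moduli of continuity: the shift `k' = k` inherits that of `ψ`, while `k' = y - x
+ k` keeps the point of evaluation and costs only `L * ‖x - y‖`. -/
lemma coneInfConv_sub_le {E : Type*} [NormedAddCommGroup E] {L : ℝ} {ψ : E → ℝ}
    (hb : ∀ x, BddBelow (Set.range fun h : E => ψ (x + h) + L * ‖h‖)) {c : ℝ} {x y : E}
    (h : ∀ k, ∃ k', ψ (x + k') + L * ‖k'‖ ≤ ψ (y + k) + L * ‖k‖ + c) :
    coneInfConv L ψ x - coneInfConv L ψ y ≤ c := by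
  have : coneInfConv L ψ x - c ≤ coneInfConv L ψ y := by
    refine le_ciInf fun k => ?_
    obtain ⟨k', hk'⟩ := h k
    have := ciInf_le (hb x) k'
    unfold coneInfConv
    linarith
  linarith

/-- Elements of the `s`-Hölder unit ball are uniform limits of Lipschitz elements. -/
lemma exists_lipschitz_approx (hs0 : 0 < s) (hs1 : s < 1) (hψ : ψ ∈ holderUnitBall s Ω)
    {ε : ℝ} (hε : 0 < ε) :
    ∃ φ ∈ holderUnitBall s Ω, (∃ L : ℝ, 0 < L ∧ ∀ x y, |φ x - φ y| ≤ L * ‖x - y‖) ∧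
      ∀ x, |φ x - ψ x| ≤ 2 * ε := by
  obtain ⟨L, hL, hLε⟩ := exists_rpow_le_mul_add hs0 hs1 hε
  rw [mem_holderUnitBall_iff hs0] at hψ
  obtain ⟨hψ0, hψs⟩ := hψ
  have hlow : ∀ x h, ψ x - ε ≤ ψ (x + h) + L * ‖h‖ := fun x h => by
    have h1 := (le_abs_self _).trans (hψs x (x + h))
    rw [show x - (x + h) = -h by abel, norm_neg] at h1
    linarith [hLε ‖h‖ (norm_nonneg _)]
  have hb : ∀ x, BddBelow (Set.range fun h => ψ (x + h) + L * ‖h‖) := fun x =>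
    ⟨ψ x - ε, by rintro _ ⟨h, rfl⟩; exact hlow x h⟩
  set w := coneInfConv L ψ with hw
  have hwlow : ∀ x, ψ x - ε ≤ w x := fun x => le_ciInf (hlow x)
  have hwup : ∀ x, w x ≤ ψ x := fun x => by
    have h := ciInf_le (hb x) 0
    rw [add_zero, norm_zero, mul_zero, add_zero] at h
    exact h
  have hwL : ∀ x y, w x - w y ≤ L * ‖x - y‖ := fun x y =>
    coneInfConv_sub_le hb fun k => ⟨y - x + k, by
      rw [show x + (y - x + k) = y + k by abel]
      have := mul_le_mul_of_nonneg_left (norm_add_le (y - x) k) hL.le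
      rw [norm_sub_rev y x] at this
      linarith⟩
  have hws : ∀ x y, w x - w y ≤ ‖x - y‖ ^ s := fun x y =>
    coneInfConv_sub_le hb fun k => ⟨k, by
      have := (le_abs_self _).trans (hψs (x + k) (y + k))
      rw [add_sub_add_right_eq_sub] at this
      linarith⟩
  -- Outside `Ω` the infimal convolution lies in `[-ε, 0]`, not necessarily at `0`. The map `T`
  -- collapses this interval to `0`, is 1-Lipschitz and moves points by at most `ε`, so the zero
  -- values return without harm to either modulus.
  set T : ℝ → ℝ := fun t => max t 0 + min (t + ε) 0 with hT
  have hT1 : ∀ a b, |T a - T b| ≤ |a - b| := fun a b => by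
    simp only [hT]
    rcases max_cases a 0 with h1 | h1 <;> rcases max_cases b 0 with h2 | h2 <;>
    rcases min_cases (a + ε) 0 with h3 | h3 <;> rcases min_cases (b + ε) 0 with h4 | h4 <;>
    rw [h1.1, h2.1, h3.1, h4.1] <;> rcases abs_cases (a - b) with h5 | h5 <;>
    rw [h5.1, abs_le] <;> constructor <;> linarith
  have hT2 : ∀ a, |T a - a| ≤ ε := fun a => by
    simp only [hT]
    rcases max_cases a 0 with h1 | h1 <;>
    rcases min_cases (a + ε) 0 with h3 | h3 <;>
    rw [h1.1, h3.1, abs_le] <;> constructor <;> linarith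
  have habs : ∀ {c : EuclideanSpace ℝ (Fin N) → EuclideanSpace ℝ (Fin N) → ℝ},
      (∀ x y, c x y = c y x) → (∀ x y, w x - w y ≤ c x y) →
      ∀ x y, |T (w x) - T (w y)| ≤ c x y := fun hc h x y =>
    (hT1 _ _).trans (abs_sub_le_iff.2 ⟨h x y, (h y x).trans_eq (hc y x)⟩)
  refine ⟨fun x => T (w x), (mem_holderUnitBall_iff hs0).2 ⟨fun x hx => ?_, ?_⟩, ⟨L, hL, ?_⟩,
    fun x => ?_⟩
  · have h1 := hwlow x
    have h2 := hwup x
    rw [hψ0 x hx] at h1 h2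
    simp only [hT]
    rw [max_eq_right h2, min_eq_right (by linarith), add_zero]
  · exact habs (c := fun x y => ‖x - y‖ ^ s) (fun x y => by rw [norm_sub_rev]) hws
  · exact habs (c := fun x y => L * ‖x - y‖) (fun x y => by rw [norm_sub_rev]) hwL
  · have h1 := abs_le.1 (hT2 (w x))
    have := hwlow x
    have := hwup x
    rw [abs_le]
    constructor <;> linarith

/-! ### Finite energy of Lipschitz elements of the ball. -/

lemma continuous_of_mem_holderUnitBall (hs0 : 0 < s) (hφ : φ ∈ holderUnitBall s Ω) :
    Continuous φ := by
  rw [mem_holderUnitBall_iff hs0] at hφ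
  refine continuous_iff_continuousAt.2 fun x => ?_
  refine tendsto_iff_norm_sub_tendsto_zero.2 (squeeze_zero (fun _ => norm_nonneg _)
    (fun y => hφ.2 y x) ?_)
  have : Continuous fun y : EuclideanSpace ℝ (Fin N) => ‖y - x‖ ^ s :=
    (continuous_id.sub continuous_const).norm.rpow_const fun _ => Or.inr hs0.le
  simpa [Real.zero_rpow hs0.ne'] using this.tendsto x

lemma exists_abs_le_of_continuous (hΩ : Bornology.IsBounded Ω) (hφ : Continuous φ)
    (h0 : ∀ x, x ∉ Ω → φ x = 0) : ∃ M : ℝ, 0 < M ∧ ∀ x, |φ x| ≤ M := by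
  obtain ⟨C, hC⟩ := hΩ.isCompact_closure.exists_bound_of_continuousOn hφ.continuousOn
  refine ⟨max C 1, by positivity, fun x => ?_⟩
  by_cases hx : x ∈ Ω
  · exact (hC x (subset_closure hx)).trans (le_max_left _ _)
  · rw [h0 x hx, abs_zero]
    positivity

/-- The radial kernel dominating the `s`-Hölder quotient of a bounded Lipschitz function. -/
lemma integrable_min_div_norm (hN : 1 ≤ N) (hs0 : 0 < s) (hs1 : s < 1) {L M : ℝ} (hL : 0 < L)
    (hM : 0 < M) :
    Integrable (fun h : EuclideanSpace ℝ (Fin N) =>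
      min (L * ‖h‖) M / ‖h‖ ^ s * (‖h‖ ^ N)⁻¹) := by
  have : Nonempty (Fin N) := ⟨⟨0, hN⟩⟩
  have key := integrable_fun_norm_addHaar (E := EuclideanSpace ℝ (Fin N)) volume
    (f := fun t : ℝ => min (L * t) M / t ^ s * (t ^ N)⁻¹)
  refine key.2 ?_
  rw [finrank_euclideanSpace, Fintype.card_fin]
  have hmeas : Measurable fun y : ℝ =>
      y ^ (N - 1) • (min (L * y) M / y ^ s * (y ^ N)⁻¹) := by fun_prop
  -- The polar factor `y ^ (N - 1)` against `y ^ N` leaves `1 / y`. The result is at most `L * y ^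
  -- (-s)` near `0`, integrable as `s < 1`, and `M * y ^ (-s - 1)` at infinity, integrable as `s >
  -- 0`.
  have hval : ∀ y : ℝ, 0 < y → y ^ (N - 1) • (min (L * y) M / y ^ s * (y ^ N)⁻¹)
      = min (L * y) M * y ^ (-s - 1) := fun y hy => by
    obtain ⟨n, rfl⟩ : ∃ n, N = n + 1 := ⟨N - 1, by omega⟩
    rw [Real.rpow_sub_one hy.ne', Real.rpow_neg hy.le, Nat.add_sub_cancel, smul_eq_mul, pow_succ]
    have := (Real.rpow_pos_of_pos hy s).ne'
    field_simp
  have hmin : ∀ y : ℝ, 0 < y → 0 ≤ min (L * y) M := fun y hy => by positivity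
  rw [← Set.Ioc_union_Ioi_eq_Ioi zero_le_one, integrableOn_union]
  constructor
  · have h1 : IntegrableOn (fun y : ℝ => L * y ^ (-s)) (Set.Ioc 0 1) :=
      (((intervalIntegrable_iff_integrableOn_Ioc_of_le zero_le_one).1
        (intervalIntegral.intervalIntegrable_rpow' (by linarith))).const_mul L)
    refine Integrable.mono' h1 hmeas.aestronglyMeasurable ?_
    filter_upwards [ae_restrict_mem measurableSet_Ioc] with y hy
    rw [hval y hy.1, Real.norm_of_nonneg (mul_nonneg (hmin y hy.1) (Real.rpow_nonneg hy.1.le _)),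
      Real.rpow_sub_one hy.1.ne']
    calc min (L * y) M * (y ^ (-s) / y) ≤ L * y * (y ^ (-s) / y) :=
          mul_le_mul_of_nonneg_right (min_le_left _ _)
            (div_nonneg (Real.rpow_nonneg hy.1.le _) hy.1.le)
      _ = L * y ^ (-s) := by field_simp [hy.1.ne']
  · have h1 : IntegrableOn (fun y : ℝ => M * y ^ (-s - 1)) (Set.Ioi 1) :=
      (integrableOn_Ioi_rpow_of_lt (by linarith) one_pos).const_mul M
    refine Integrable.mono' h1 hmeas.aestronglyMeasurable ?_
    filter_upwards [ae_restrict_mem measurableSet_Ioi] with y hy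
    have hy0 : 0 < y := one_pos.trans hy
    rw [hval y hy0, Real.norm_of_nonneg (mul_nonneg (hmin y hy0) (Real.rpow_nonneg hy0.le _))]
    exact mul_le_mul_of_nonneg_right (min_le_right _ _) (Real.rpow_nonneg hy0.le _)

lemma lintegral_abs_holderQuotient_lt_top (hN : 1 ≤ N) (hs0 : 0 < s) (hs1 : s < 1)
    (hΩo : IsOpen Ω) (hΩ : Bornology.IsBounded Ω) (h0 : ∀ x, x ∉ Ω → φ x = 0)
    {L : ℝ} (hL : 0 < L) (hφL : ∀ x y, |φ x - φ y| ≤ L * ‖x - y‖) (hφ : Continuous φ) :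
    ∫⁻ z, ENNReal.ofReal |holderQuotient s φ z| ∂(muMeasure N) < ⊤ := by
  obtain ⟨M, hM, hφM⟩ := exists_abs_le_of_continuous hΩ hφ h0
  set k : EuclideanSpace ℝ (Fin N) → ℝ≥0∞ := fun h =>
    ENNReal.ofReal (min (L * ‖h‖) (2 * M) / ‖h‖ ^ s * (‖h‖ ^ N)⁻¹) with hk
  have hkm : Measurable k := by
    simp only [hk]
    fun_prop
  have hkfin : ∫⁻ h, k h < ⊤ := by
    have h1 := (integrable_min_div_norm hN hs0 hs1 hL (show 0 < 2 * M by positivity)).2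
    rwa [hasFiniteIntegral_iff_ofReal (Eventually.of_forall fun h => by positivity)] at h1
  set I : EuclideanSpace ℝ (Fin N) → ℝ≥0∞ := Ω.indicator 1 with hI
  have hIm : Measurable I := measurable_one.indicator hΩo.measurableSet
  have hIint : ∫⁻ x, I x < ⊤ := by
    rw [hI, lintegral_indicator_one hΩo.measurableSet]
    exact hΩ.measure_lt_top
  have hdens : Measurable fun z : EuclideanSpace ℝ (Fin N) × EuclideanSpace ℝ (Fin N) =>
      ENNReal.ofReal ((‖z.1 - z.2‖ ^ N)⁻¹) := by fun_prop
  have hsub : Measurable fun z : EuclideanSpace ℝ (Fin N) × EuclideanSpace ℝ (Fin N) =>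
      z.1 - z.2 := by fun_prop
  -- The quotient vanishes unless one of the two points is in `Ω`. Each indicator makes one variable
  -- range over a set of finite measure, and translation invariance integrates the kernel in the
  -- other.
  have hpt : ∀ z : EuclideanSpace ℝ (Fin N) × EuclideanSpace ℝ (Fin N),
      ENNReal.ofReal ((‖z.1 - z.2‖ ^ N)⁻¹) * ENNReal.ofReal |holderQuotient s φ z| ≤
        I z.1 * k (z.1 - z.2) + I z.2 * k (z.1 - z.2) := fun z => by
    have hle : ENNReal.ofReal ((‖z.1 - z.2‖ ^ N)⁻¹) * ENNReal.ofReal |holderQuotient s φ z| ≤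
        k (z.1 - z.2) := by
      rw [← ENNReal.ofReal_mul (by positivity), mul_comm]
      refine ENNReal.ofReal_le_ofReal ?_
      simp only [holderQuotient, abs_div]
      rw [abs_of_nonneg (Real.rpow_nonneg (norm_nonneg (z.1 - z.2)) s)]
      gcongr
      refine le_min (hφL _ _) ((abs_sub _ _).trans ?_)
      linarith [hφM z.1, hφM z.2]
    by_cases h1 : z.1 ∈ Ω
    · refine hle.trans (le_add_right ?_)
      simp [hI, h1]
    by_cases h2 : z.2 ∈ Ω
    · refine hle.trans (le_add_left ?_)
      simp [hI, h2]
    · simp [holderQuotient, h0 _ h1, h0 _ h2]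
  calc ∫⁻ z, ENNReal.ofReal |holderQuotient s φ z| ∂(muMeasure N)
      ≤ ∫⁻ z : EuclideanSpace ℝ (Fin N) × EuclideanSpace ℝ (Fin N),
        ENNReal.ofReal ((‖z.1 - z.2‖ ^ N)⁻¹) * ENNReal.ofReal |holderQuotient s φ z|
          ∂(volume.prod volume) := lintegral_withDensity_le_lintegral_mul _ hdens _
    _ ≤ ∫⁻ z : EuclideanSpace ℝ (Fin N) × EuclideanSpace ℝ (Fin N),
        (I z.1 * k (z.1 - z.2) + I z.2 * k (z.1 - z.2)) ∂(volume.prod volume) :=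
        lintegral_mono hpt
    _ = (∫⁻ x, I x) * (∫⁻ h, k h) + (∫⁻ x, I x) * ∫⁻ h, k h := by
        have hm1 : Measurable fun z : EuclideanSpace ℝ (Fin N) × EuclideanSpace ℝ (Fin N) =>
          I z.1 * k (z.1 - z.2) := (hIm.comp measurable_fst).mul (hkm.comp hsub)
        have hm2 : Measurable fun z : EuclideanSpace ℝ (Fin N) × EuclideanSpace ℝ (Fin N) =>
          I z.2 * k (z.1 - z.2) := (hIm.comp measurable_snd).mul (hkm.comp hsub)
        rw [lintegral_add_left hm1, lintegral_prod _ hm1.aemeasurable,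
          lintegral_prod_symm _ hm2.aemeasurable]
        congr 1
        · rw [← lintegral_mul_const _ hIm]
          congr 1
          ext x
          exact (lintegral_const_mul (I x) (hkm.comp (measurable_const.sub measurable_id))).trans
            (congrArg _ (lintegral_sub_left_eq_self k x))
        · rw [← lintegral_mul_const _ hIm]
          congr 1
          ext y
          exact (lintegral_const_mul (I y) (hkm.comp (measurable_id.sub measurable_const))).trans
            (congrArg _ (lintegral_sub_right_eq_self k y))
    _ < ⊤ := ENNReal.add_lt_top.2 ⟨ENNReal.mul_lt_top hIint hkfin, ENNReal.mul_lt_top hIint hkfin⟩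

/-- On the ball `|D^s φ| ≤ 1`, so `t ^ p ≤ t` for `p ≥ 1`. All dependence on `G` is thus confined to
the prefactor, and the remaining integral is fixed. -/
lemma fracModular_const_mul_le {G : ℝ → ℝ} {p q : ℝ} (hG : IsOrliczFunction G)
    (hg : HasGrowth G p q) (hp : 1 ≤ p) (hs0 : 0 < s) (hφ : φ ∈ holderUnitBall s Ω)
    {c : ℝ} (hc0 : 0 ≤ c) (hc1 : c ≤ 1) :
    fracModular s G (fun x => c * φ x) ≤ ENNReal.ofReal (G 1 * c ^ p) *
      ∫⁻ z, ENNReal.ofReal |holderQuotient s φ z| ∂(muMeasure N) := by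
  rw [mem_holderUnitBall_iff hs0] at hφ
  unfold fracModular
  rw [← lintegral_const_mul' _ _ ENNReal.ofReal_ne_top]
  refine lintegral_mono fun z => ?_
  rw [← ENNReal.ofReal_mul (mul_nonneg (hG.nonneg 1) (Real.rpow_nonneg hc0 _))]
  refine ENNReal.ofReal_le_ofReal ?_
  have h1 : |holderQuotient s φ z| ≤ 1 := by
    rw [holderQuotient, abs_div, abs_of_nonneg (Real.rpow_nonneg (norm_nonneg (z.1 - z.2)) s)]
    exact div_le_one_of_le₀ (hφ.2 _ _) (Real.rpow_nonneg (norm_nonneg _) _)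
  have h2 : holderQuotient s (fun x => c * φ x) z = c * holderQuotient s φ z := by
    simp only [holderQuotient]
    ring
  rw [h2, ← hG.map_abs, abs_mul, abs_of_nonneg hc0]
  set t := |holderQuotient s φ z|
  have ht : 0 ≤ t := abs_nonneg _
  calc G (c * t) ≤ G 1 * (c * t) ^ p :=
        hG.le_mul_rpow hg (mul_nonneg hc0 ht) (mul_le_one₀ hc1 ht h1)
    _ = G 1 * c ^ p * t ^ p := by rw [Real.mul_rpow hc0 ht, mul_assoc]
    _ ≤ G 1 * c ^ p * t := mul_le_mul_of_nonneg_left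
        (Real.rpow_le_self_of_le_one ht h1 hp)
        (mul_nonneg (hG.nonneg 1) (Real.rpow_nonneg hc0 _))

lemma modular_lt_top {G : ℝ → ℝ} (hG : IsOrliczFunction G) (hΩo : IsOpen Ω)
    (hΩ : Bornology.IsBounded Ω) (hφ : Continuous φ) (h0 : ∀ x, x ∉ Ω → φ x = 0) :
    modular G φ < ⊤ := by
  obtain ⟨M, hM, hφM⟩ := exists_abs_le_of_continuous hΩ hφ h0
  calc modular G φ ≤ ∫⁻ x, Ω.indicator (fun _ => ENNReal.ofReal (G M)) x := by
        refine lintegral_mono fun x => ?_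
        by_cases hx : x ∈ Ω
        · simp only [hx, Set.indicator_of_mem]
          exact ENNReal.ofReal_le_ofReal (hG.le_of_abs_le ((hφM x).trans (le_abs_self M)))
        · simp [hx, h0 x hx, hG.map_zero]
    _ = ENNReal.ofReal (G M) * volume Ω := by
        rw [lintegral_indicator_const hΩo.measurableSet]
    _ < ⊤ := ENNReal.mul_lt_top ENNReal.ofReal_lt_top hΩ.measure_lt_top

end HolderUnitBall

/-! ### Vanishing everywhere outside the domain. -/

/-- Boundary points of an open set with Lipschitz boundary are limits of exterior points, so a
continuous function vanishing a.e. outside the set vanishes everywhere outside it. -/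
lemma HasLipschitzBoundary.eq_zero_of_notMem {N : ℕ} {Ω : Set (EuclideanSpace ℝ (Fin N))}
    (hΩ : HasLipschitzBoundary Ω) (hΩo : IsOpen Ω) {w : EuclideanSpace ℝ (Fin N) → ℝ}
    (hw : Continuous w) (h0 : ∀ᵐ x, x ∉ Ω → w x = 0) {x : EuclideanSpace ℝ (Fin N)}
    (hx : x ∉ Ω) : w x = 0 := by
  have hext : ∀ y, y ∉ closure Ω → w y = 0 := by
    intro y hy
    by_contra hwy
    have hopen : IsOpen ((closure Ω)ᶜ ∩ {z | w z ≠ 0}) :=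
      isClosed_closure.isOpen_compl.inter (isOpen_ne_fun hw continuous_const)
    refine (hopen.measure_pos volume ⟨y, hy, hwy⟩).ne' (measure_mono_null ?_ (ae_iff.1 h0))
    rintro z ⟨hz1, hz2⟩ h
    exact hz2 (h fun hz => hz1 (subset_closure hz))
  by_cases hxc : x ∈ closure Ω
  · have hxf : x ∈ frontier Ω := ⟨hxc, by rwa [hΩo.interior_eq]⟩
    obtain ⟨r, e, K, γ, hr, he, hγ, hloc⟩ := hΩ x hxf
    have hle : inner ℝ e x ≤ γ (x - inner ℝ e x • e) :=
      not_lt.1 fun h => hx ((hloc x (Metric.mem_ball_self hr)).2 h)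
    -- Moving along `-e` keeps the projection to `e^⊥` and lowers the coordinate, hence lands
    -- strictly below the graph. That condition is open, so the new point is outside `closure Ω`.
    have hout : ∀ᶠ t : ℝ in 𝓝[>] 0, w (x - t • e) = 0 := by
      filter_upwards [Ioo_mem_nhdsGT hr] with t ht
      refine hext _ fun hcl => ?_
      have hmem : x - t • e ∈ Metric.ball x r := by
        rw [Metric.mem_ball, dist_eq_norm, sub_sub_cancel_left, norm_neg, norm_smul, he, mul_one,
          Real.norm_of_nonneg ht.1.le]
        exact ht.2
      have hopen : IsOpen {y : EuclideanSpace ℝ (Fin N) |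
          inner ℝ e y < γ (y - inner ℝ e y • e)} :=
        isOpen_lt (by fun_prop) (hγ.continuous.comp (by fun_prop))
      have hin : inner ℝ e (x - t • e) = inner ℝ e x - t := by
        rw [inner_sub_right, inner_smul_right, real_inner_self_eq_norm_sq, he]
        ring
      have hmem2 : inner ℝ e (x - t • e) <
          γ (x - t • e - inner ℝ e (x - t • e) • e) := by
        rw [hin, show x - t • e - (inner ℝ e x - t) • e = x - inner ℝ e x • e by
          rw [sub_smul]; abel]
        linarith [ht.1]
      obtain ⟨y, ⟨hy1, hy2⟩, hyΩ⟩ :=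
        mem_closure_iff.1 hcl _ (Metric.isOpen_ball.inter hopen) ⟨hmem, hmem2⟩
      exact lt_asymm hy2 ((hloc y hy1).1 hyΩ)
    have hlim : Tendsto (fun t : ℝ => w (x - t • e)) (𝓝[>] 0) (𝓝 (w x)) := by
      have hc : Continuous fun t : ℝ => w (x - t • e) := hw.comp (by fun_prop)
      have := hc.tendsto 0
      simp only [zero_smul, sub_zero] at this
      exact this.mono_left nhdsWithin_le_nhds
    exact tendsto_nhds_unique hlim (tendsto_const_nhds.congr' (hout.mono fun _ h => h.symm))
  · exact hext x hxc

/-! ### Pairing with `f`, uniform closeness, and admissible competitors. -/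

section BoundedFactor

variable {X : Type*} [MeasurableSpace X] {μ : Measure X} {f v w : X → ℝ}

lemma integrable_mul_of_ae_abs_le (hf : Integrable f μ) (hw : AEStronglyMeasurable w μ) {C : ℝ}
    (h : ∀ᵐ x ∂μ, |w x| ≤ C) : Integrable (fun x => f x * w x) μ :=
  Integrable.mono' (hf.norm.mul_const C) (hf.1.mul hw) (h.mono fun x hx => by
    rw [norm_mul]
    exact mul_le_mul_of_nonneg_left hx (norm_nonneg _))

lemma abs_integral_mul_sub_le (hf : Integrable f μ) (hv : Integrable (fun x => f x * v x) μ)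
    (hw : Integrable (fun x => f x * w x) μ) {ε : ℝ} (h : ∀ᵐ x ∂μ, |v x - w x| ≤ ε) :
    |(∫ x, f x * v x ∂μ) - ∫ x, f x * w x ∂μ| ≤ (∫ x, |f x| ∂μ) * ε := by
  rw [← integral_sub hv hw, ← integral_mul_const, ← Real.norm_eq_abs]
  refine norm_integral_le_of_norm_le (hf.norm.mul_const ε) (h.mono fun x hx => ?_)
  rw [← mul_sub, norm_mul]
  exact mul_le_mul_of_nonneg_left hx (norm_nonneg _)

end BoundedFactor

lemma eventually_ae_abs_sub_le {X : Type*} [MeasurableSpace X] {μ : Measure X} {u : ℕ → X → ℝ}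
    {w : X → ℝ} (h : Tendsto (fun k => eLpNorm (fun x => u k x - w x) ⊤ μ) atTop (𝓝 0))
    {ε : ℝ} (hε : 0 < ε) : ∀ᶠ k in atTop, ∀ᵐ x ∂μ, |u k x - w x| ≤ ε := by
  filter_upwards [h.eventually (gt_mem_nhds (ENNReal.ofReal_pos.2 hε))] with k hk
  rw [eLpNorm_exponent_top] at hk
  filter_upwards [ae_le_eLpNormEssSup (f := fun x => u k x - w x) (μ := μ)] with x hx
  have := hx.trans hk.le
  rwa [Real.enorm_eq_ofReal_abs, ENNReal.ofReal_le_ofReal_iff hε.le] at this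

lemma const_mul_mem_fracOrliczSobolevZero {N : ℕ} (hN : 1 ≤ N) {s : ℝ} (hs0 : 0 < s) (hs1 : s < 1)
    {Ω : Set (EuclideanSpace ℝ (Fin N))} (hΩo : IsOpen Ω) (hΩ : Bornology.IsBounded Ω)
    {G : ℝ → ℝ} {p q : ℝ} (hG : IsOrliczFunction G) (hg : HasGrowth G p q) (hp : 1 ≤ p)
    {φ : EuclideanSpace ℝ (Fin N) → ℝ} (hφ : φ ∈ holderUnitBall s Ω)
    {L : ℝ} (hL : 0 < L) (hφL : ∀ x y, |φ x - φ y| ≤ L * ‖x - y‖) {c : ℝ} (hc0 : 0 ≤ c)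
    (hc1 : c ≤ 1) : (fun x => c * φ x) ∈ fracOrliczSobolevZero s G Ω := by
  have hφc := continuous_of_mem_holderUnitBall hs0 hφ
  have h0 : ∀ x, x ∉ Ω → c * φ x = 0 := fun x hx => by rw [hφ.1 x hx, mul_zero]
  have hcc : Continuous fun x => c * φ x := continuous_const.mul hφc
  exact ⟨⟨hcc.aemeasurable, modular_lt_top hG hΩo hΩ hcc h0,
    (fracModular_const_mul_le hG hg hp hs0 hφ hc0 hc1).trans_lt
      (ENNReal.mul_lt_top ENNReal.ofReal_lt_top
        (lintegral_abs_holderQuotient_lt_top hN hs0 hs1 hΩo hΩ hφ.1 hL hφL hφc))⟩,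
    Eventually.of_forall h0⟩

/-! ### The Hölder bound for the limit. -/

lemma muMeasure_pos_of_isOpen {N : ℕ}
    {O : Set (EuclideanSpace ℝ (Fin N) × EuclideanSpace ℝ (Fin N))}
    (hO : IsOpen O) (hne : O.Nonempty) (hdiag : ∀ z ∈ O, z.1 ≠ z.2) : muMeasure N O ≠ 0 := by
  have hdens : Measurable fun z : EuclideanSpace ℝ (Fin N) × EuclideanSpace ℝ (Fin N) =>
      ENNReal.ofReal ((‖z.1 - z.2‖ ^ N)⁻¹) := by fun_prop
  rw [muMeasure, Ne, withDensity_apply_eq_zero hdens]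
  -- For `N ≥ 1` the density takes the default value `0` on the diagonal, as the inverse of `0`; off
  -- the diagonal it is positive.
  have : {z : EuclideanSpace ℝ (Fin N) × EuclideanSpace ℝ (Fin N) |
      ENNReal.ofReal ((‖z.1 - z.2‖ ^ N)⁻¹) ≠ 0} ∩ O = O := by
    refine Set.inter_eq_right.2 fun z hz => ?_
    have : 0 < ‖z.1 - z.2‖ := norm_pos_iff.2 (sub_ne_zero.2 (hdiag z hz))
    exact (ENNReal.ofReal_pos.2 (by positivity)).ne'
  rw [this]
  exact (hO.measure_pos _ hne).ne'

/-- Uniformly bounded energies with exponents tending to infinity force the `s`-Hölder bound. -/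
lemma abs_sub_le_rpow_of_bounded_fracModular {N : ℕ} {s : ℝ} (hs0 : 0 < s) {G : ℕ → ℝ → ℝ}
    {p q : ℕ → ℝ} (hG : ∀ n, IsOrliczFunction (G n)) (hg : ∀ n, HasGrowth (G n) (p n) (q n))
    (hp : Tendsto p atTop atTop) (hnorm : Tendsto (fun n => (G n 1) ^ (1 / p n)) atTop (𝓝 1))
    {u : ℕ → EuclideanSpace ℝ (Fin N) → ℝ} {w : EuclideanSpace ℝ (Fin N) → ℝ} (hw : Continuous w)
    (hlim : ∀ ε : ℝ, 0 < ε → ∀ᶠ n in atTop, ∀ᵐ x, |u n x - w x| ≤ ε) {C : ℝ≥0∞} (hC : C < ⊤)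
    (hb : ∀ᶠ n in atTop, fracModular s (G n) (u n) ≤ C) (x y : EuclideanSpace ℝ (Fin N)) :
    |w x - w y| ≤ ‖x - y‖ ^ s := by
  by_contra! hxy
  have hne : x ≠ y := by
    rintro rfl
    simp [Real.zero_rpow hs0.ne'] at hxy
  have hd : 0 < ‖x - y‖ ^ s := Real.rpow_pos_of_pos (norm_pos_iff.2 (sub_ne_zero.2 hne)) _
  obtain ⟨c, hc1, hc⟩ : ∃ c : ℝ, 1 < c ∧ c * ‖x - y‖ ^ s < |w x - w y| := by
    obtain ⟨c, h1, h2⟩ := exists_between ((one_lt_div hd).2 hxy)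
    exact ⟨c, h1, (lt_div_iff₀ hd).1 h2⟩
  -- The room `2 * η` absorbs the error of `u n` at both points, so on `O` almost everywhere the
  -- quotient of `u n` is still at least `c`.
  obtain ⟨η, hη, hηc⟩ : ∃ η : ℝ, 0 < η ∧ c * ‖x - y‖ ^ s + 2 * η < |w x - w y| :=
    ⟨(|w x - w y| - c * ‖x - y‖ ^ s) / 4, by linarith, by linarith⟩
  set O : Set (EuclideanSpace ℝ (Fin N) × EuclideanSpace ℝ (Fin N)) :=
    {z | c * ‖z.1 - z.2‖ ^ s + 2 * η < |w z.1 - w z.2|} ∩ {z | z.1 ≠ z.2} with hOdef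
  have hO : IsOpen O := by
    refine (isOpen_lt ?_ ?_).inter (isOpen_ne_fun continuous_fst continuous_snd)
    · exact (continuous_const.mul ((continuous_fst.sub continuous_snd).norm.rpow_const
        fun _ => Or.inr hs0.le)).add continuous_const
    · exact ((hw.comp continuous_fst).sub (hw.comp continuous_snd)).abs
  have hm : muMeasure N O ≠ 0 := muMeasure_pos_of_isOpen hO ⟨(x, y), hηc, hne⟩ fun z hz => hz.2
  have hlow : ∀ᶠ n in atTop, ENNReal.ofReal (G n 1 * c ^ p n) * muMeasure N O ≤ C := by
    filter_upwards [hlim η hη, hb] with n hn hbn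
    refine le_trans ?_ hbn
    have h1 : ∀ᵐ z ∂(muMeasure N), |u n z.1 - w z.1| ≤ η :=
      (muMeasure_absolutelyContinuous N).ae_le
        (Measure.quasiMeasurePreserving_fst.ae hn)
    have h2 : ∀ᵐ z ∂(muMeasure N), |u n z.2 - w z.2| ≤ η :=
      (muMeasure_absolutelyContinuous N).ae_le
        (Measure.quasiMeasurePreserving_snd.ae hn)
    rw [← lintegral_indicator_const hO.measurableSet]
    refine lintegral_mono_ae ?_
    filter_upwards [h1, h2] with z hz1 hz2
    by_cases hz : z ∈ O
    · rw [Set.indicator_of_mem hz]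
      refine ENNReal.ofReal_le_ofReal (((hG n).mul_rpow_le (hg n) hc1.le).trans
        ((hG n).le_of_abs_le ?_))
      have hzd : 0 < ‖z.1 - z.2‖ ^ s :=
        Real.rpow_pos_of_pos (norm_pos_iff.2 (sub_ne_zero.2 hz.2)) _
      rw [holderQuotient, abs_div, abs_of_pos hzd, le_div_iff₀ hzd, abs_of_pos (by linarith)]
      have hz3 : c * ‖z.1 - z.2‖ ^ s + 2 * η < |w z.1 - w z.2| := hz.1
      have h3 : |w z.1 - w z.2| ≤
          |u n z.1 - w z.1| + |u n z.1 - u n z.2| + |u n z.2 - w z.2| := by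
        calc |w z.1 - w z.2| = |-(u n z.1 - w z.1) + (u n z.1 - u n z.2) + (u n z.2 - w z.2)| := by
              congr 1; ring
          _ ≤ _ := (abs_add_three _ _ _).trans_eq (by rw [abs_neg])
      linarith
    · rw [Set.indicator_of_notMem hz]
      exact zero_le
  have htop : Tendsto (fun n => ENNReal.ofReal (G n 1 * c ^ p n) * muMeasure N O) atTop
      (𝓝 (⊤ * muMeasure N O)) :=
    ENNReal.Tendsto.mul_const (ENNReal.tendsto_ofReal_atTop.comp
      (tendsto_mul_rpow_atTop (fun n => (hG n).pos one_pos) hp hnorm hc1)) (Or.inl (by simp))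
  rw [ENNReal.top_mul hm] at htop
  exact absurd (le_of_tendsto htop hlow) (not_le.2 hC)

/-! ### Passage to the limit. -/

theorem corollary5p4 {N : ℕ} (hN : 1 ≤ N) (s : ℝ) (hs0 : 0 < s) (hs1 : s < 1)
    (Ω : Set (EuclideanSpace ℝ (Fin N))) (hΩ_open : IsOpen Ω)
    (hΩ_bdd : Bornology.IsBounded Ω) (hΩ_lip : HasLipschitzBoundary Ω)
    (G : ℕ → ℝ → ℝ) (pminus pplus : ℕ → ℝ) (β : ℝ) (hβ : 1 < β)
    (hG : ∀ n, IsOrliczFunction (G n))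
    (hgrowth : ∀ n, HasGrowth (G n) (pminus n) (pplus n))
    (hp : Tendsto pminus atTop atTop) (hpβ : ∀ n, pplus n ≤ β * pminus n)
    -- normalization: holds if `G n 1 = 1` for all `n`, and for `G n t = |t| ^ p n / p n`
    (hnorm : Tendsto (fun n => (G n 1) ^ (1 / pminus n)) atTop (𝓝 1))
    (r : ℝ≥0∞) (hr : 1 < r) (f : EuclideanSpace ℝ (Fin N) → ℝ)
    (hf : MemLp f r (volume.restrict Ω))
    (u : ℕ → EuclideanSpace ℝ (Fin N) → ℝ)
    (hu : ∀ᶠ n in atTop, IsWeakSolution s (G n) Ω f (u n))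
    -- `uinf` is continuous and is the uniform limit on `ℝ^N` (up to null sets) of a subsequence
    (κ : ℕ → ℕ) (hκ : StrictMono κ)
    (uinf : EuclideanSpace ℝ (Fin N) → ℝ) (huinf : Continuous uinf)
    (hlim : Tendsto (fun k => eLpNorm (fun x => u (κ k) x - uinf x) ⊤ volume) atTop (𝓝 0)) :
    uinf ∈ holderUnitBall s Ω ∧
      ∀ ψ ∈ holderUnitBall s Ω, ∫ x in Ω, f x * ψ x ≤ ∫ x in Ω, f x * uinf x := by
  have hfin : IsFiniteMeasure (volume.restrict Ω) := ⟨by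
    rw [Measure.restrict_apply_univ]
    exact hΩ_bdd.measure_lt_top⟩
  have hfi : IntegrableOn f Ω := hf.integrable hr.le
  have hd : ∀ n, Differentiable ℝ (G n) := fun n =>
    (hG n).differentiable (hgrowth n).differentiableAt
  have hκt := hκ.tendsto_atTop
  have huk : ∀ᶠ k in atTop, IsWeakSolution s (G (κ k)) Ω f (u (κ k)) := hκt.eventually hu
  have hpk : Tendsto (fun k => pminus (κ k)) atTop atTop := hp.comp hκt
  have hnk : Tendsto (fun k => (G (κ k) 1) ^ (1 / pminus (κ k))) atTop (𝓝 1) := hnorm.comp hκt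
  have hclose : ∀ ε : ℝ, 0 < ε → ∀ᶠ k in atTop, ∀ᵐ x, |u (κ k) x - uinf x| ≤ ε :=
    fun ε hε => eventually_ae_abs_sub_le (u := fun k => u (κ k)) hlim hε
  have hae0 : ∀ᵐ x, x ∉ Ω → uinf x = 0 := by
    have h1 : ∀ m : ℕ, ∀ᵐ x, x ∉ Ω → |uinf x| ≤ 1 / ((m : ℝ) + 1) := fun m => by
      obtain ⟨k, hk1, hk2⟩ := (huk.and (hclose _ (Nat.one_div_pos_of_nat (n := m)))).exists
      filter_upwards [hk1.1.1.2, hk2] with x hx1 hx2 hx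
      rwa [hx1 hx, zero_sub, abs_neg] at hx2
    filter_upwards [ae_all_iff.2 h1] with x hx hxΩ
    exact abs_nonpos_iff.1 (ge_of_tendsto' tendsto_one_div_add_atTop_nhds_zero_nat
      fun m => hx m hxΩ)
  have h0 : ∀ x, x ∉ Ω → uinf x = 0 := fun x hx =>
    hΩ_lip.eq_zero_of_notMem hΩ_open huinf hae0 hx
  have hcint : ∀ w : EuclideanSpace ℝ (Fin N) → ℝ, Continuous w → (∀ x, x ∉ Ω → w x = 0) →
      IntegrableOn (fun x => f x * w x) Ω := fun w hw hw0 => by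
    obtain ⟨M, -, hM⟩ := exists_abs_le_of_continuous hΩ_bdd hw hw0
    exact integrable_mul_of_ae_abs_le hfi hw.aestronglyMeasurable (Eventually.of_forall hM)
  have hiu := hcint uinf huinf h0
  have hik : ∀ᶠ k in atTop, IntegrableOn (fun x => f x * u (κ k) x) Ω := by
    obtain ⟨M, -, hM⟩ := exists_abs_le_of_continuous hΩ_bdd huinf h0
    filter_upwards [huk, hclose 1 one_pos] with k hk1 hk2
    refine integrable_mul_of_ae_abs_le (C := M + 1) hfi
      hk1.1.1.1.1.restrict.aestronglyMeasurable (ae_restrict_of_ae (hk2.mono fun x hx => ?_))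
    have := abs_sub_abs_le_abs_sub (u (κ k) x) (uinf x)
    linarith [hM x]
  have hconv : Tendsto (fun k => ∫ x in Ω, f x * u (κ k) x) atTop
      (𝓝 (∫ x in Ω, f x * uinf x)) := by
    set A := ∫ x in Ω, |f x| with hA
    have hA0 : 0 ≤ A := integral_nonneg fun _ => abs_nonneg _
    refine Metric.tendsto_nhds.2 fun ε hε => ?_
    filter_upwards [hik, hclose (ε / (A + 1)) (by positivity)] with k hk1 hk2
    rw [Real.dist_eq]
    refine (abs_integral_mul_sub_le hfi hk1 hiu (ae_restrict_of_ae hk2)).trans_lt ?_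
    rw [← hA, mul_div_assoc', div_lt_iff₀ (by positivity)]
    nlinarith
  -- testing the minimality against `c • φ`, with `φ` Lipschitz in the Hölder unit ball
  have htest : ∀ φ ∈ holderUnitBall s Ω, (∃ L : ℝ, 0 < L ∧ ∀ x y, |φ x - φ y| ≤ L * ‖x - y‖) →
      ∀ c : ℝ, 0 ≤ c → c ≤ 1 → ∀ᶠ k in atTop,
      (∫ z, G (κ k) (holderQuotient s (u (κ k)) z) ∂(muMeasure N)) + c * ∫ x in Ω, f x * φ x ≤
        G (κ k) 1 * c ^ pminus (κ k) *
          (∫⁻ z, ENNReal.ofReal |holderQuotient s φ z| ∂(muMeasure N)).toReal +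
        ∫ x in Ω, f x * u (κ k) x := by
    rintro φ hφ ⟨L, hL, hφL⟩ c hc0 hc1
    have hφc := continuous_of_mem_holderUnitBall hs0 hφ
    filter_upwards [huk, hik, hpk.eventually_ge_atTop 1] with k hk1 hk2 hk3
    have hmem := const_mul_mem_fracOrliczSobolevZero hN hs0 hs1 hΩ_open hΩ_bdd (hG (κ k))
      (hgrowth _) hk3 hφ hL hφL hc0 hc1
    have hifφ : ∀ x, f x * (c * φ x) = c * (f x * φ x) := fun x => by ring
    have hen := hk1.energy_le (hG _) (hd _) hmem hk2
      (by simpa only [IntegrableOn, hifφ] using (hcint φ hφc hφ.1).const_mul c)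
      hfi.aestronglyMeasurable
    simp only [hifφ, integral_const_mul] at hen
    refine hen.trans (add_le_add_left ?_ _)
    have hle := fracModular_const_mul_le (hG (κ k)) (hgrowth _) hk3 hs0 hφ hc0 hc1
    rw [fracModular_eq_ofReal_integral (hG _) hmem] at hle
    have hGc : 0 ≤ G (κ k) 1 * c ^ pminus (κ k) :=
      mul_nonneg ((hG _).nonneg 1) (Real.rpow_nonneg hc0 _)
    have hfinφ := lintegral_abs_holderQuotient_lt_top hN hs0 hs1 hΩ_open hΩ_bdd hφ.1 hL hφL hφc
    have := ENNReal.toReal_mono (ENNReal.mul_lt_top ENNReal.ofReal_lt_top hfinφ).ne hle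
    rwa [ENNReal.toReal_mul, ENNReal.toReal_ofReal hGc,
      ENNReal.toReal_ofReal (integral_nonneg fun z => (hG _).nonneg _)] at this
  have hzero : (fun _ => 0 : EuclideanSpace ℝ (Fin N) → ℝ) ∈ holderUnitBall s Ω :=
    (mem_holderUnitBall_iff hs0).2 ⟨fun _ _ => rfl, fun x y => by
      rw [sub_self, abs_zero]
      positivity⟩
  refine ⟨(mem_holderUnitBall_iff hs0).2 ⟨h0, ?_⟩, fun ψ hψ => ?_⟩
  · refine abs_sub_le_rpow_of_bounded_fracModular hs0 (fun k => hG (κ k)) (fun k => hgrowth (κ k))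
      hpk hnk huinf hclose (C := ENNReal.ofReal ((∫ x in Ω, f x * uinf x) + 1))
      ENNReal.ofReal_lt_top ?_
    -- The zero competitor: as `0 ^ p = 0` for `p > 0`, the energy of the solution is at most `∫ f
    -- u`, which eventually stays below its limit plus one.
    filter_upwards [huk, htest _ hzero ⟨1, one_pos, fun x y => by
        rw [sub_self, abs_zero]
        positivity⟩ 0 le_rfl zero_le_one,
      hconv.eventually (gt_mem_nhds (lt_add_one _)), hpk.eventually_gt_atTop 0]
      with k hk1 hk2 hk3 hk4
    rw [Real.zero_rpow hk4.ne', mul_zero, zero_mul, zero_mul, zero_add, add_zero] at hk2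
    rw [fracModular_eq_ofReal_integral (hG _) hk1.1.1]
    exact ENNReal.ofReal_le_ofReal (hk2.trans hk3.le)
  · have hlip : ∀ φ ∈ holderUnitBall s Ω,
        (∃ L : ℝ, 0 < L ∧ ∀ x y, |φ x - φ y| ≤ L * ‖x - y‖) →
        ∫ x in Ω, f x * φ x ≤ ∫ x in Ω, f x * uinf x := by
      intro φ hφ hL
      have hc : ∀ c ∈ Set.Ioo (0 : ℝ) 1,
          c * ∫ x in Ω, f x * φ x ≤ ∫ x in Ω, f x * uinf x := by
        intro c hc
        -- Strictness of `c < 1` sends the energy of the competitor to zero; the energy of the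
        -- solution is dropped, being nonnegative.
        have hr0 := ((tendsto_mul_rpow_zero (fun k => (hG (κ k)).pos one_pos) hpk hnk hc.1
          hc.2).mul_const
          (∫⁻ z, ENNReal.ofReal |holderQuotient s φ z| ∂(muMeasure N)).toReal).add hconv
        rw [zero_mul, zero_add] at hr0
        refine ge_of_tendsto hr0 ?_
        filter_upwards [htest φ hφ hL c hc.1.le hc.2.le] with k hk
        have : 0 ≤ ∫ z, G (κ k) (holderQuotient s (u (κ k)) z) ∂(muMeasure N) :=
          integral_nonneg fun z => (hG _).nonneg _
        linarith
      have ht : Tendsto (fun c : ℝ => c * ∫ x in Ω, f x * φ x) (𝓝[<] 1)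
          (𝓝 (1 * ∫ x in Ω, f x * φ x)) :=
        (tendsto_id.mono_left nhdsWithin_le_nhds).mul_const _
      rw [one_mul] at ht
      exact le_of_tendsto ht (eventually_of_mem (Ioo_mem_nhdsLT one_pos) hc)
    have hA0 : 0 ≤ ∫ x in Ω, |f x| := integral_nonneg fun _ => abs_nonneg _
    refine le_of_forall_pos_le_add fun ε hε => ?_
    set A := ∫ x in Ω, |f x| with hA
    -- The approximation error is twice the parameter, hence the factor `2`; `A + 1` keeps the
    -- denominator positive when `A = 0`.
    obtain ⟨φ, hφ, hL, hφψ⟩ := exists_lipschitz_approx hs0 hs1 hψ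
      (ε := ε / (2 * (A + 1))) (by positivity)
    have h1 := abs_integral_mul_sub_le hfi
      (hcint φ (continuous_of_mem_holderUnitBall hs0 hφ) hφ.1)
      (hcint ψ (continuous_of_mem_holderUnitBall hs0 hψ) hψ.1) (Eventually.of_forall hφψ)
    have h2 : A * (2 * (ε / (2 * (A + 1)))) ≤ ε := by
      rw [show A * (2 * (ε / (2 * (A + 1)))) = A * ε / (A + 1) by field_simp,
        div_le_iff₀ (by positivity)]
      nlinarith
    rw [← hA] at h1
    linarith [(abs_le.1 h1).1, hlip φ hφ hL]
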